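/- Let $X$ be a locally compact, second countable, metrizable space. Call an equivalence relation on a topological space *proper* if its quotient space is Hausdorff and the quotient map is a local homeomorphism. Let $\mathcal R=(\{U_n\}_{n\ge 0},\{R_n\}_{n\ge 0})$ be a generalized approximately proper equivalence relation on $X$: the $U_n$ are open subsets with $X=U_0\supseteq U_1\supseteq U_2\supseteq\cdots$, each $R_n$ is a proper equivalence relation on $U_n$, $R_0$ is the identity relation, and $R_n\cap(U_n\times U_m)\subseteq R_m$ whenever $n\le m$. Let $\{k_n\}_{n\ge 1}$ be a potential for $\mathcal R$: each $k_n:U_n\to\mathbb R$ is continuous, and $k_n(x)=k_n(y)$ whenever $(x,y)\in R_{n-1}\cap(U_n\times U_n)$. Put $h_n=\sum_{i=1}^n k_i|_{U_n}$ (so $h_0=0$) and $\rho_n=e^{h_n}$ on $U_n$. Let $R=\bigcup_n R_n$, regarded as a groupoid with unit space $X$, range map $(x,y)\mapsto x$ and source map $(x,y)\mapsto y$, and with the inductive limit topology: a set $V\subseteq R$ is open if and only if $V\cap R_n$ is open in $R_n$ for every $n$, where $R_n$ carries the topology induced from $X\times X$. Let $c$ be the well-defined function on $R$ with $c(x,y)=h_n(x)-h_n(y)$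 for $(x,y)\in R_n$, and let $D=e^{c}$. A measure $\mu$ on the Borel sets of $X$ is $D$-quasi-invariant if $$\int_X\sum_{y:(x,y)\in R} f(x,y)\,d\mu(x)=\int_X\sum_{x:(x,y)\in R} f(x,y)\,D(x,y)\,d\mu(y)\qquad\text{for every } f\in C_c(R).$$ For $x\in U_n$ let $\zeta_n(x)=\sum_{y:(x,y)\in R_n}\rho_n(y)\in(0,\infty]$, and for a Borel measurable $f:U_n\to[0,\infty]$ let $$P_{\rho_n}(f)(x)=\sum_{y:(x,y)\in R_n} f(y)\,\rho_n(y)\,\zeta_n(y)^{-1},\qquad \infty^{-1}=0,\quad 0\cdot\infty=0.$$ For a Borel measure $\nu$ on $U_n$ let $P_{\rho_n}^*(\nu)$ be the Borel measure on $U_n$ with $\int f\,dP_{\rho_n}^*(\nu)=\int P_{\rho_n}(f)\,d\nu$ for all Borel measurable $f:U_n\to[0,\infty]$. Then a finite Borel measure $\mu$ on $X$ is $D$-quasi-invariant if and only if $$P_{\rho_n}^*\big(\mu|_{U_n}\big)=\mu|_{U_n}\qquad\text{for every } n\ge 0,$$ where $\mu|_{U_n}$ is the measure $A\mapsto\mu(A)$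 on the Borel subsets of $U_n$. -/

import Mathlib

open MeasureTheory Set TopologicalSpace
open scoped ENNReal NNReal

/-! ### σ-additive operators on nonnegative functions and the induced map on measures -/

/-- A σ-additive operator from the `[0,∞]`-valued measurable functions on `A` to those on `B`:
it preserves measurability, is positively homogeneous, and commutes with countable sums.
(`T` is given on all functions, but only its values on measurable ones matter.) -/
structure SigmaAdditive {A B : Type*} [MeasurableSpace A] [MeasurableSpace B]
    (T : (A → ℝ≥0∞) → (B → ℝ≥0∞)) : Prop where
  measurable : ∀ f, Measurable f → Measurable (T f)
  const_mul : ∀ (c : ℝ≥0) (f), Measurable f → T (fun a => c * f a) = fun b => c * T f b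
  tsum : ∀ f : ℕ → A → ℝ≥0∞, (∀ n, Measurable (f n)) →
    T (fun a => ∑' n, f n a) = fun b => ∑' n, T (f n) b

theorem SigmaAdditive.map_zero {A B : Type*} [MeasurableSpace A] [MeasurableSpace B]
    {T : (A → ℝ≥0∞) → (B → ℝ≥0∞)} (hT : SigmaAdditive T) :
    T (fun _ => 0) = fun _ => 0 := by
  have := hT.const_mul 0 (fun _ => 0) measurable_const
  simpa using this

theorem indicator_iUnion_eq_tsum {A : Type*} {S : ℕ → Set A}
    (hS : Pairwise (Function.onFun Disjoint S)) (f : A → ℝ≥0∞) (a : A) :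
    (⋃ n, S n).indicator f a = ∑' n, (S n).indicator f a := by
  by_cases ha : a ∈ ⋃ n, S n
  · obtain ⟨n, hn⟩ := mem_iUnion.1 ha
    rw [tsum_eq_single n, indicator_of_mem ha, indicator_of_mem hn]
    intro m hm
    exact indicator_of_notMem (fun h => disjoint_left.1 (hS hm) h hn) f
  · rw [indicator_of_notMem ha]
    symm
    rw [ENNReal.tsum_eq_zero]
    exact fun n => indicator_of_notMem (fun h => ha (mem_iUnion.2 ⟨n, h⟩)) f

/-- The measure `T^*(ν)` on `A`, given on measurable sets by `T^*(ν)(S) = ∫ T(1_S) dν`. -/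
noncomputable def SigmaAdditive.dual {A B : Type*} [MeasurableSpace A] [MeasurableSpace B]
    {T : (A → ℝ≥0∞) → (B → ℝ≥0∞)} (hT : SigmaAdditive T) (ν : Measure B) : Measure A :=
  Measure.ofMeasurable (fun S _ => ∫⁻ b, T (S.indicator (fun _ => 1)) b ∂ν)
    (by simp [indicator_empty, hT.map_zero])
    (by
      intro S hS hd
      have hm : ∀ n, Measurable ((S n).indicator (fun _ => (1 : ℝ≥0∞))) :=
        fun n => measurable_const.indicator (hS n)
      have h : (⋃ n, S n).indicator (fun _ => (1 : ℝ≥0∞))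
          = fun a => ∑' n, (S n).indicator (fun _ => (1 : ℝ≥0∞)) a := by
        funext a
        exact indicator_iUnion_eq_tsum hd _ a
      rw [h, hT.tsum _ hm, lintegral_tsum fun n => (hT.measurable _ (hm n)).aemeasurable])

theorem SigmaAdditive.dual_apply {A B : Type*} [MeasurableSpace A] [MeasurableSpace B]
    {T : (A → ℝ≥0∞) → (B → ℝ≥0∞)} (hT : SigmaAdditive T) (ν : Measure B)
    {S : Set A} (hS : MeasurableSet S) :
    hT.dual ν S = ∫⁻ b, T (S.indicator (fun _ => 1)) b ∂ν :=
  Measure.ofMeasurable_apply S hS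

theorem SigmaAdditive.map_add {A B : Type*} [MeasurableSpace A] [MeasurableSpace B]
    {T : (A → ℝ≥0∞) → (B → ℝ≥0∞)} (hT : SigmaAdditive T) {f g : A → ℝ≥0∞}
    (hf : Measurable f) (hg : Measurable g) :
    T (fun a => f a + g a) = fun b => T f b + T g b := by
  let F : ℕ → A → ℝ≥0∞ := fun n => if n = 0 then f else if n = 1 then g else fun _ => 0
  have hF : ∀ n, Measurable (F n) := by
    intro n
    simp only [F]
    split_ifs
    exacts [hf, hg, measurable_const]
  have key := hT.tsum F hF
  have h1 : (fun a => ∑' n, F n a) = fun a => f a + g a := by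
    funext a
    rw [tsum_eq_sum (s := Finset.range 2)]
    · simp [Finset.sum_range_succ, F]
    · intro n hn
      have h0 : n ≠ 0 := by rintro rfl; simp at hn
      have h1 : n ≠ 1 := by rintro rfl; simp at hn
      simp [F, h0, h1]
  have h2 : (fun b => ∑' n, T (F n) b) = fun b => T f b + T g b := by
    funext b
    rw [tsum_eq_sum (s := Finset.range 2)]
    · simp [Finset.sum_range_succ, F]
    · intro n hn
      have h0 : n ≠ 0 := by rintro rfl; simp at hn
      have h1 : n ≠ 1 := by rintro rfl; simp at hn
      simp [F, h0, h1, hT.map_zero]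
  rw [h1, h2] at key
  exact key

/-- The property that characterizes `T^*(ν)`: `∫ f dT^*(ν) = ∫ T(f) dν` for all measurable
`f ≥ 0`. -/
theorem SigmaAdditive.lintegral_dual {A B : Type*} [MeasurableSpace A] [MeasurableSpace B]
    {T : (A → ℝ≥0∞) → (B → ℝ≥0∞)} (hT : SigmaAdditive T) (ν : Measure B)
    {f : A → ℝ≥0∞} (hf : Measurable f) :
    ∫⁻ a, f a ∂(hT.dual ν) = ∫⁻ b, T f b ∂ν := by
  have hs : ∀ g : SimpleFunc A ℝ≥0,
      ∫⁻ a, (g a : ℝ≥0∞) ∂(hT.dual ν) = ∫⁻ b, T (fun a => (g a : ℝ≥0∞)) b ∂ν := by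
    intro g
    induction g using SimpleFunc.induction with
    | @const c S hS =>
      have h : (fun a => (((SimpleFunc.piecewise S hS (SimpleFunc.const A c)
          (SimpleFunc.const A 0)) a : ℝ≥0) : ℝ≥0∞))
          = fun a => (c : ℝ≥0∞) * S.indicator (fun _ => 1) a := by
        funext a
        by_cases ha : a ∈ S <;> simp [ha]
      have hm : Measurable (S.indicator (fun _ => (1 : ℝ≥0∞))) := measurable_const.indicator hS
      rw [h, hT.const_mul c _ hm, lintegral_const_mul _ hm,
        lintegral_const_mul _ (hT.measurable _ hm), ← hT.dual_apply ν hS]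
      congr 1
      exact lintegral_indicator_one hS
    | @add g₁ g₂ _ h₁ h₂ =>
      have m₁ : Measurable fun a => (g₁ a : ℝ≥0∞) := g₁.measurable.coe_nnreal_ennreal
      have m₂ : Measurable fun a => (g₂ a : ℝ≥0∞) := g₂.measurable.coe_nnreal_ennreal
      simp only [SimpleFunc.coe_add, Pi.add_apply, ENNReal.coe_add]
      rw [hT.map_add m₁ m₂, lintegral_add_left m₁, lintegral_add_left (hT.measurable _ m₁), h₁, h₂]
  have hm : ∀ n, Measurable fun a => (SimpleFunc.eapproxDiff f n a : ℝ≥0∞) :=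
    fun n => (SimpleFunc.eapproxDiff f n).measurable.coe_nnreal_ennreal
  have hsum : f = fun a => ∑' n, (SimpleFunc.eapproxDiff f n a : ℝ≥0∞) := by
    funext a
    exact (SimpleFunc.tsum_eapproxDiff f hf a).symm
  conv_lhs => rw [hsum]
  conv_rhs => rw [hsum]
  rw [hT.tsum _ hm, lintegral_tsum fun n => (hm n).aemeasurable,
    lintegral_tsum fun n => (hT.measurable _ (hm n)).aemeasurable]
  exact tsum_congr fun n => hs _

/-! ### Proper equivalence relations -/

/-- An equivalence relation on a topological space is proper when the quotient space is
Hausdorff and the quotient map is a local homeomorphism. -/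
def IsProperRel {Y : Type*} [TopologicalSpace Y] (r : Setoid Y) : Prop :=
  T2Space (Quotient r) ∧ IsLocalHomeomorph (Quotient.mk r)

/-- `E(f)(x) = ∑_{y ∼ x} f(y)`, with values in `[0,∞]`. -/
noncomputable def classSum {Y : Type*} (r : Setoid Y) (f : Y → ℝ≥0∞) (x : Y) : ℝ≥0∞ :=
  ∑' y : {y : Y // r x y}, f y

/-- The partition function `ζ = E(ρ)`. -/
noncomputable def partitionFunction {Y : Type*} (r : Setoid Y) (ρ : Y → ℝ) : Y → ℝ≥0∞ :=
  classSum r fun y => ENNReal.ofReal (ρ y)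

/-- `P_ρ(f) = E(f ρ ζ⁻¹)`, with the conventions `∞⁻¹ = 0` and `0 * ∞ = 0`. -/
noncomputable def condOp {Y : Type*} (r : Setoid Y) (ρ : Y → ℝ) (f : Y → ℝ≥0∞) : Y → ℝ≥0∞ :=
  classSum r fun y => f y * ENNReal.ofReal (ρ y) * (partitionFunction r ρ y)⁻¹

theorem classSum_tsum {Y : Type*} (r : Setoid Y) (f : ℕ → Y → ℝ≥0∞) :
    classSum r (fun y => ∑' n, f n y) = fun x => ∑' n, classSum r (f n) x := by
  funext x
  exact ENNReal.tsum_comm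

theorem measurable_classSum {Y : Type*} [TopologicalSpace Y] [SecondCountableTopology Y]
    [MeasurableSpace Y] [BorelSpace Y] {r : Setoid Y} (hr : IsProperRel r)
    {f : Y → ℝ≥0∞} (hf : Measurable f) : Measurable (classSum r f) := by
  rcases isEmpty_or_nonempty Y with hY | hY
  · exact measurable_of_empty _
  choose e he hee using hr.2
  obtain ⟨s, hs, hcov⟩ := TopologicalSpace.countable_cover_nhds fun x => (e x).open_source.mem_nhds (he x)
  have hne : s.Nonempty := by
    by_contra h
    rw [not_nonempty_iff_eq_empty] at h
    subst h
    simp at hcov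
    exact (empty_ne_univ hcov).elim
  obtain ⟨u, rfl⟩ := hs.exists_eq_range hne
  let W : ℕ → Set Y := fun n => (e (u n)).source
  have hW : ∀ n, MeasurableSet (W n) := fun n => (e (u n)).open_source.measurableSet
  have hWu : ⋃ n, disjointed W n = univ := by
    rw [iUnion_disjointed, ← hcov]
    simp [W]
  have hsum : f = fun y => ∑' n, (disjointed W n).indicator f y := by
    funext y
    rw [← indicator_iUnion_eq_tsum (disjoint_disjointed W) f y, hWu, indicator_univ]
  rw [hsum, classSum_tsum]
  refine Measurable.tsum fun n => ?_
  set g := (disjointed W n).indicator f with hg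
  have hgm : Measurable g := hf.indicator (MeasurableSet.disjointed hW n)
  have hg0 : ∀ y, y ∉ (e (u n)).source → g y = 0 := fun y hy =>
    indicator_of_notMem (fun h => hy (disjointed_subset W n h)) f
  set V : Set Y := Quotient.mk r ⁻¹' (e (u n)).target with hV
  have hVo : IsOpen V := (e (u n)).open_target.preimage continuous_quotient_mk'
  have hmk : ∀ y, (e (u n)) y = Quotient.mk r y := fun y => by rw [hee (u n)]
  refine measurable_of_restrict_of_restrict_compl hVo.measurableSet ?_ ?_
  · have h : V.domRestrict (classSum r g) =
        fun x : V => g ((e (u n)).symm (Quotient.mk r x)) := by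
      funext ⟨x, hx⟩
      have hx' : Quotient.mk r x ∈ (e (u n)).target := hx
      have hrel : r x ((e (u n)).symm (Quotient.mk r x)) := by
        apply Quotient.exact
        rw [← hmk ((e (u n)).symm _), (e (u n)).right_inv hx']
      simp only [domRestrict_apply, classSum]
      rw [tsum_eq_single ⟨_, hrel⟩]
      rintro ⟨y, hy⟩ hne
      apply hg0
      intro hys
      apply hne
      ext
      change y = _
      have : Quotient.mk r x = e (u n) y := by
        rw [hmk]
        exact Quotient.sound hy
      exact ((congrArg (e (u n)).symm this).trans ((e (u n)).left_inv hys)).symm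
    rw [h]
    apply hgm.comp
    apply Continuous.measurable
    exact (e (u n)).continuousOn_symm.comp_continuous
      (continuous_quotient_mk'.comp continuous_subtype_val) fun x => x.2
  · have h : Vᶜ.domRestrict (classSum r g) = fun _ => 0 := by
      funext ⟨x, hx⟩
      simp only [domRestrict_apply, classSum, ENNReal.tsum_eq_zero]
      rintro ⟨y, hy⟩
      apply hg0
      intro hys
      apply hx
      change Quotient.mk r x ∈ (e (u n)).target
      rw [Quotient.sound hy, ← hmk]
      exact (e (u n)).map_source hys
    rw [h]
    exact measurable_const

theorem sigmaAdditive_condOp {Y : Type*} [TopologicalSpace Y] [SecondCountableTopology Y]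
    [MeasurableSpace Y] [BorelSpace Y] {r : Setoid Y} (hr : IsProperRel r)
    {ρ : Y → ℝ} (hρ : Continuous ρ) : SigmaAdditive (condOp r ρ) where
  measurable f hf := by
    have h1 : Measurable fun y => ENNReal.ofReal (ρ y) := hρ.measurable.ennreal_ofReal
    exact measurable_classSum hr ((hf.mul h1).mul (measurable_classSum hr h1).inv)
  const_mul c f _ := by
    funext x
    simp only [condOp, classSum, ← ENNReal.tsum_mul_left, mul_assoc]
  tsum f _ := by
    simp only [condOp, ← ENNReal.tsum_mul_right]
    exact classSum_tsum r _

/-! ### Generalized approximately proper equivalence relations -/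

/-- A generalized approximately proper equivalence relation ("gap") on `X`: open sets `U n`,
with a proper equivalence relation `R n` on each `U n`. -/
structure Gap (X : Type*) [TopologicalSpace X] where
  U : ℕ → Set X
  R : ∀ n, Setoid (U n)
  isOpen_U : ∀ n, IsOpen (U n)
  isProper : ∀ n, IsProperRel (R n)
  U_zero : U 0 = univ
  U_antitone : Antitone U
  /-- `R 0` is the identity relation. -/
  R_zero : ∀ x y : U 0, R 0 x y ↔ x = y
  /-- `R n ∩ (U n × U m) ⊆ R m` whenever `n ≤ m`. -/
  R_inter_subset : ∀ {n m : ℕ}, n ≤ m → ∀ (x y : U n), R n x y → ∀ hy : (y : X) ∈ U m,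
    ∃ hx : (x : X) ∈ U m, R m ⟨x, hx⟩ ⟨y, hy⟩

namespace Gap

variable {X : Type*} [TopologicalSpace X]

/-- `R n`, as a subset of `X × X`. -/
def graph (𝓡 : Gap X) (n : ℕ) : Set (X × X) :=
  {p | ∃ (h₁ : p.1 ∈ 𝓡.U n) (h₂ : p.2 ∈ 𝓡.U n), 𝓡.R n ⟨p.1, h₁⟩ ⟨p.2, h₂⟩}

/-- The union `⋃ n, R n` (an equivalence relation on `X`), as the set of arrows of the principal
groupoid with unit space `X`, range map `(x, y) ↦ x` and source map `(x, y) ↦ y`. -/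
def Arrows (𝓡 : Gap X) : Type _ := {p : X × X // ∃ n, p ∈ 𝓡.graph n}

/-- The range map `(x, y) ↦ x`. -/
def range {𝓡 : Gap X} (γ : 𝓡.Arrows) : X := γ.1.1

/-- The source map `(x, y) ↦ y`. -/
def source {𝓡 : Gap X} (γ : 𝓡.Arrows) : X := γ.1.2

/-- The inclusion of `R n` in `⋃ n, R n`. -/
def incl (𝓡 : Gap X) (n : ℕ) (p : 𝓡.graph n) : 𝓡.Arrows := ⟨p.1, n, p.2⟩

/-- The inductive limit topology: a set of arrows is open when its intersection with every `R n`
is open for the topology which `R n` inherits from `X × X`. -/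
instance instTopologicalSpaceArrows (𝓡 : Gap X) : TopologicalSpace 𝓡.Arrows :=
  ⨆ n, TopologicalSpace.coinduced (𝓡.incl n) inferInstance

theorem isOpen_arrows_iff (𝓡 : Gap X) (s : Set 𝓡.Arrows) :
    IsOpen s ↔ ∀ n, IsOpen (𝓡.incl n ⁻¹' s) := by
  simp only [isOpen_iSup_iff, isOpen_coinduced]

theorem equivalence_arrows (𝓡 : Gap X) :
    Equivalence fun x y : X => ∃ n, (x, y) ∈ 𝓡.graph n where
  refl x := ⟨0, 𝓡.U_zero ▸ mem_univ x, 𝓡.U_zero ▸ mem_univ x, (𝓡.R 0).refl _⟩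
  symm := by
    rintro x y ⟨n, hx, hy, h⟩
    exact ⟨n, hy, hx, (𝓡.R n).symm h⟩
  trans := by
    rintro x y z ⟨n, hx, hy, h⟩ ⟨m, hy', hz, h'⟩
    rcases le_total n m with hnm | hnm
    · obtain ⟨hx', h''⟩ := 𝓡.R_inter_subset hnm _ _ h hy'
      exact ⟨m, hx', hz, (𝓡.R m).trans h'' h'⟩
    · obtain ⟨hz', h''⟩ := 𝓡.R_inter_subset hnm _ _ ((𝓡.R m).symm h') hy
      exact ⟨n, hx, hz', (𝓡.R n).trans h ((𝓡.R n).symm h'')⟩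

/-- A potential for a gap. `k n` is the function usually written `k_{n+1} : U_{n+1} → ℝ`; there
is no `k_0`. -/
structure Potential (𝓡 : Gap X) where
  k : ∀ n, 𝓡.U (n + 1) → ℝ
  continuous_k : ∀ n, Continuous (k n)
  k_eq : ∀ n (x y : 𝓡.U (n + 1)),
    𝓡.R n ⟨x, 𝓡.U_antitone n.le_succ x.2⟩ ⟨y, 𝓡.U_antitone n.le_succ y.2⟩ → k n x = k n y

namespace Potential

variable {𝓡 : Gap X}

/-- `h_n = k_1 + ⋯ + k_n` on `U n`. -/
noncomputable def h (k : 𝓡.Potential) : ∀ n, 𝓡.U n → ℝ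
  | 0 => fun _ => 0
  | n + 1 => fun x => k.h n ⟨x, 𝓡.U_antitone n.le_succ x.2⟩ + k.k n x

theorem continuous_h (k : 𝓡.Potential) : ∀ n, Continuous (k.h n)
  | 0 => continuous_const
  | n + 1 => ((k.continuous_h n).comp
      (continuous_subtype_val.subtype_mk _)).add (k.continuous_k n)

/-- `c_n(x, y) = h_n(x) - h_n(y)` on `R n`. -/
noncomputable def cn (k : 𝓡.Potential) (n : ℕ) (p : 𝓡.graph n) : ℝ :=
  k.h n ⟨p.1.1, p.2.choose⟩ - k.h n ⟨p.1.2, p.2.choose_spec.choose⟩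

open Classical in
/-- The cocycle `c` on `⋃ n, R n` whose restriction to each `R n` is `c_n`
(see `c_incl` below). -/
noncomputable def c (k : 𝓡.Potential) (γ : 𝓡.Arrows) : ℝ :=
  k.cn (Nat.find γ.2) ⟨γ.1, Nat.find_spec γ.2⟩

theorem cn_eq_of_le (k : 𝓡.Potential) {n m : ℕ} (hnm : n ≤ m) (p : X × X)
    (hn : p ∈ 𝓡.graph n) (hm : p ∈ 𝓡.graph m) : k.cn n ⟨p, hn⟩ = k.cn m ⟨p, hm⟩ := by
  induction m, hnm using Nat.le_induction with
  | base => rfl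
  | succ m hnm ih =>
    obtain ⟨h₁, h₂, hr⟩ := id hn
    have hy : p.2 ∈ 𝓡.U (m + 1) := hm.choose_spec.choose
    obtain ⟨hx', hr'⟩ :=
      𝓡.R_inter_subset hnm _ _ hr (show p.2 ∈ 𝓡.U m from 𝓡.U_antitone m.le_succ hy)
    rw [ih ⟨hx', _, hr'⟩]
    have hk := k.k_eq m ⟨p.1, hm.choose⟩ ⟨p.2, hy⟩ hr'
    simp only [cn, h]
    rw [hk]
    ring

/-- `c` is well defined: it coincides with `c_n` on each `R n`. -/
theorem c_incl (k : 𝓡.Potential) (n : ℕ) (p : 𝓡.graph n) : k.c (𝓡.incl n p) = k.cn n p := by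
  classical
  have hle : Nat.find (𝓡.incl n p).2 ≤ n := Nat.find_min' _ p.2
  have := k.cn_eq_of_le hle p.1 (Nat.find_spec (𝓡.incl n p).2) p.2
  rw [← this]
  rfl

/-- The multiplicative cocycle `D = e^c`. -/
noncomputable def D (k : 𝓡.Potential) (γ : 𝓡.Arrows) : ℝ := Real.exp (k.c γ)

/-- `ρ_n = e^{h_n}` on `U n`. -/
noncomputable def ρ (k : 𝓡.Potential) (n : ℕ) (x : 𝓡.U n) : ℝ := Real.exp (k.h n x)

theorem continuous_ρ (k : 𝓡.Potential) (n : ℕ) : Continuous (k.ρ n) :=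
  Real.continuous_exp.comp (k.continuous_h n)

/-- The map `P_{ρ_n}^*` on measures on `U n`, where `P_{ρ_n}` is formed with `R n` and `ρ_n`. -/
noncomputable def dualCondOp [SecondCountableTopology X] [MeasurableSpace X] [BorelSpace X]
    (k : 𝓡.Potential) (n : ℕ) (ν : Measure (𝓡.U n)) : Measure (𝓡.U n) :=
  (sigmaAdditive_condOp (𝓡.isProper n) (k.continuous_ρ n)).dual ν

end Potential

end Gap

/-- Quasi-invariance of a measure `μ` on the unit space `X` of a (Hausdorff) étale groupoid,
with arrow space `G`, range map `r` and source map `s`, relative to `D : G → ℝ`: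
`∫ ∑_{r(γ) = x} f(γ) dμ(x) = ∫ ∑_{s(γ) = x} f(γ) D(γ) dμ(x)` for every `f ∈ C_c(G)`. -/
def IsQuasiInvariant {G X : Type*} [TopologicalSpace G] [MeasurableSpace X]
    (r s : G → X) (D : G → ℝ) (μ : Measure X) : Prop :=
  ∀ f : G → ℂ, Continuous f → HasCompactSupport f →
    ∫ x, ∑' γ : {γ : G // r γ = x}, f γ ∂μ = ∫ x, ∑' γ : {γ : G // s γ = x}, f γ * D γ ∂μ

/-! Write `R` for the space of arrows. Both sides of the quasi-invariance identity are integrals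
over `R`: the left one against the measure obtained from `μ` by counting along the range fibers, the
right one against `D` times the measure obtained by counting along the source fibers. Since range
and source are local homeomorphisms and `R` is Hausdorff, locally compact and second countable, both
measures are finite on compact sets, and agreeing on `C_c(R)` means being equal. So quasi-invariance
can be tested on all `[0,∞]`-valued Borel functions (`isQuasiInvariant_iff_lintegral`).

Each `R n` is open in `R` (`isOpen_graph_inter`) and the `R n` cover `R`, so by countable additivity
the two measures need only be compared on each `R n`. There `D(x, y) = ρ_n(x) / ρ_n(y)`, and the
comparison becomes a statement about one proper relation and the restriction of `μ` to `U n`.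

For one proper relation with weight `ρ`, partition function `ζ` and measure `ν`, quasi-invariance
says that a kernel `K(x, y)` on the relation has the same integral when summed over `y`, and when
summed over `x` with weight `ρ(x) / ρ(y)`. If it holds, take `K(x, y) = f(y) ρ(y) / ζ(y)`: the first
integral is that of `P_ρ(f)`, the second that of `f`, provided `ζ < ∞` almost everywhere. Finiteness
of `ν` ensures this (`measure_partitionFunction_eq_top`). Conversely `P_ρ` sends both sums of a
kernel to the same function (`condOp_classSum_kernel`, an exchange of summations), so if `P_ρ^*`
fixes `ν` their integrals agree. -/

open Filter Topology

/-! ### Local homeomorphisms and local sections of proper relations -/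

theorem isLocalHomeomorph_of_isOpenMap {A B : Type*} [TopologicalSpace A] [TopologicalSpace B]
    {f : A → B} (hc : Continuous f) (ho : IsOpenMap f)
    (hi : ∀ a, ∃ V, IsOpen V ∧ a ∈ V ∧ InjOn f V) : IsLocalHomeomorph f := by
  rw [isLocalHomeomorph_iff_isOpenEmbedding_restrict]
  intro a
  obtain ⟨V, hV, haV, hinj⟩ := hi a
  refine ⟨V, hV.mem_nhds haV, IsOpenEmbedding.of_continuous_injective_isOpenMap
    (hc.comp continuous_subtype_val) (injOn_iff_injective.1 hinj) ?_⟩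
  exact ho.comp hV.isOpenMap_subtype_val

theorem IsLocalHomeomorph.exists_isOpen_injOn {A B : Type*} [TopologicalSpace A]
    [TopologicalSpace B] {f : A → B} (hf : IsLocalHomeomorph f) (a : A) :
    ∃ V, IsOpen V ∧ a ∈ V ∧ InjOn f V := by
  obtain ⟨e, ha, he⟩ := hf a
  exact ⟨e.source, e.open_source, ha, he ▸ e.injOn⟩

/-- Compact neighbourhoods are carried back along the inverse charts. Applied to the range map, this
gives the local compactness of the arrow space that comparing measures through `C_c` requires. -/
theorem IsLocalHomeomorph.locallyCompactSpace_of_t2 {A B : Type*} [TopologicalSpace A]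
    [TopologicalSpace B] [T2Space A] [LocallyCompactSpace B] {f : A → B}
    (hf : IsLocalHomeomorph f) : LocallyCompactSpace A := by
  have : WeaklyLocallyCompactSpace A := by
    refine ⟨fun a => ?_⟩
    obtain ⟨e, ha, -⟩ := hf a
    obtain ⟨K, hK, hKt, hKc⟩ :=
      local_compact_nhds (e.open_target.mem_nhds (e.map_source ha))
    refine ⟨e.symm '' K, hKc.image_of_continuousOn (e.continuousOn_symm.mono hKt), ?_⟩
    filter_upwards [e.continuousAt ha hK, e.open_source.mem_nhds ha] with b hb hbs
    exact ⟨e b, hb, e.left_inv hbs⟩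
  infer_instance

theorem IsProperRel.exists_isOpen_injOn {Y : Type*} [TopologicalSpace Y] {r : Setoid Y}
    (hr : IsProperRel r) (y : Y) :
    ∃ V, IsOpen V ∧ y ∈ V ∧ ∀ a ∈ V, ∀ b ∈ V, r a b → a = b := by
  obtain ⟨V, hV, hy, hinj⟩ := hr.2.exists_isOpen_injOn y
  exact ⟨V, hV, hy, fun a ha b hb h => hinj ha hb (Quotient.sound h)⟩

/-- Equivalent points of a proper equivalence relation are joined by a continuous local
section of the relation. -/
theorem IsProperRel.exists_section {Y : Type*} [TopologicalSpace Y] {r : Setoid Y}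
    (hr : IsProperRel r) {x y : Y} (h : r x y) :
    ∃ φ : Y → Y, ContinuousAt φ x ∧ φ x = y ∧ ∀ᶠ x' in 𝓝 x, r x' (φ x') := by
  obtain ⟨e, hy, he⟩ := hr.2 y
  have hmk : ∀ a, e a = Quotient.mk r a := fun a => by rw [he]
  have hxy : Quotient.mk r x = e y := (Quotient.sound h).trans (hmk y).symm
  have hxt : Quotient.mk r x ∈ e.target := hxy ▸ e.map_source hy
  have hq : Continuous (Quotient.mk r) := continuous_quotient_mk'
  refine ⟨fun a => e.symm (Quotient.mk r a), ?_, ?_, ?_⟩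
  · exact ContinuousAt.comp (f := Quotient.mk r) (e.continuousAt_symm hxt) hq.continuousAt
  · simp only [hxy]
    exact e.left_inv hy
  · filter_upwards [hq.continuousAt (e.open_target.mem_nhds hxt)] with a ha
    apply Quotient.exact
    rw [← hmk (e.symm _)]
    exact (e.right_inv ha).symm

/-! ### The arrow space is Hausdorff, second countable and étale -/

namespace Gap

variable {X : Type*} [TopologicalSpace X] (𝓡 : Gap X)

theorem exists_isOpen_graph_inj (n : ℕ) {y : X} (hy : y ∈ 𝓡.U n) :
    ∃ V, IsOpen V ∧ y ∈ V ∧ ∀ a ∈ V, ∀ b ∈ V, (a, b) ∈ 𝓡.graph n → a = b := by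
  obtain ⟨V, hV, hyV, hinj⟩ := (𝓡.isProper n).exists_isOpen_injOn ⟨y, hy⟩
  refine ⟨(↑) '' V, (𝓡.isOpen_U n).isOpenMap_subtype_val V hV, ⟨_, hyV, rfl⟩, ?_⟩
  rintro _ ⟨a, ha, rfl⟩ _ ⟨b, hb, rfl⟩ ⟨_, _, h⟩
  exact congrArg _ (hinj a ha b hb h)

theorem exists_graph_section (n : ℕ) {x y : X} (h : (x, y) ∈ 𝓡.graph n) :
    ∃ φ : X → X, ContinuousAt φ x ∧ φ x = y ∧ ∀ᶠ x' in 𝓝 x, (x', φ x') ∈ 𝓡.graph n := by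
  obtain ⟨hx, hy, hr⟩ := h
  obtain ⟨φ, hφ, hφx, hφr⟩ := (𝓡.isProper n).exists_section hr
  have hemb : IsOpenEmbedding ((↑) : 𝓡.U n → X) := (𝓡.isOpen_U n).isOpenEmbedding_subtypeVal
  classical
  -- The value off `U n` is arbitrary: `U n` is open, so only the germ of `φ` at `x` matters.
  let ψ : X → X := fun a => if ha : a ∈ 𝓡.U n then φ ⟨a, ha⟩ else a
  have hψ : ∀ a : 𝓡.U n, ψ a = φ a := fun a => dif_pos a.2
  refine ⟨ψ, ?_, ?_, ?_⟩
  · rw [show x = ((⟨x, hx⟩ : 𝓡.U n) : X) from rfl, ← hemb.continuousAt_iff]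
    have : ψ ∘ ((↑) : 𝓡.U n → X) = (↑) ∘ φ := funext hψ
    rw [this]
    exact continuous_subtype_val.continuousAt.comp hφ
  · rw [show ψ x = φ ⟨x, hx⟩ from hψ ⟨x, hx⟩, hφx]
  · rw [show x = ((⟨x, hx⟩ : 𝓡.U n) : X) from rfl, ← hemb.map_nhds_eq, eventually_map]
    filter_upwards [hφr] with a ha
    rw [hψ]
    exact ⟨a.2, (φ a).2, ha⟩

variable {𝓡} in
theorem graph_symm {n : ℕ} {x y : X} (h : (x, y) ∈ 𝓡.graph n) : (y, x) ∈ 𝓡.graph n := by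
  obtain ⟨hx, hy, h⟩ := h
  exact ⟨hy, hx, (𝓡.R n).symm h⟩

variable {𝓡} in
theorem graph_trans {n : ℕ} {x y z : X} (h : (x, y) ∈ 𝓡.graph n) (h' : (y, z) ∈ 𝓡.graph n) :
    (x, z) ∈ 𝓡.graph n := by
  obtain ⟨hx, hy, h⟩ := h
  obtain ⟨_, hz, h'⟩ := h'
  exact ⟨hx, hz, (𝓡.R n).trans h h'⟩

variable {𝓡} in
theorem graph_of_le {n m : ℕ} (hnm : n ≤ m) {x y : X} (h : (x, y) ∈ 𝓡.graph n)
    (hy : y ∈ 𝓡.U m) : (x, y) ∈ 𝓡.graph m := by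
  obtain ⟨_, _, h⟩ := h
  obtain ⟨hx, h⟩ := 𝓡.R_inter_subset hnm _ _ h hy
  exact ⟨hx, hy, h⟩

/-- If `m ≤ n`, the gap condition reduces membership in `R n` to the open condition `y ∈ U n`. If `n
≤ m`, a local section `φ` of `R n` through `(x, y)` stays in `U m`, so by the gap condition it is
also a section of `R m`. Near `y` no two distinct points are `R m`-equivalent, so every nearby arrow
of `R m` lies on the graph of `φ`, hence in `R n`. -/
theorem isOpen_graph_inter (n m : ℕ) : IsOpen {p : 𝓡.graph m | (p : X × X) ∈ 𝓡.graph n} := by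
  rcases le_total m n with hmn | hnm
  · have : {p : 𝓡.graph m | (p : X × X) ∈ 𝓡.graph n} = {p : 𝓡.graph m | p.1.2 ∈ 𝓡.U n} := by
      ext ⟨⟨x, y⟩, hp⟩
      exact ⟨fun h => h.2.1, fun h => graph_of_le hmn hp h⟩
    rw [this]
    exact (𝓡.isOpen_U n).preimage (continuous_snd.comp continuous_subtype_val)
  · rw [isOpen_iff_mem_nhds]
    rintro ⟨⟨x, y⟩, hm⟩ (hn : (x, y) ∈ 𝓡.graph n)
    have hy : y ∈ 𝓡.U m := hm.2.1
    obtain ⟨φ, hφ, hφx, hφr⟩ := 𝓡.exists_graph_section n hn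
    obtain ⟨V, hV, hyV, hinj⟩ := 𝓡.exists_isOpen_graph_inj m hy
    have h1 : ContinuousAt (fun p : 𝓡.graph m => p.1.1) ⟨(x, y), hm⟩ :=
      (continuous_fst.comp continuous_subtype_val).continuousAt
    have h2 : ContinuousAt (fun p : 𝓡.graph m => p.1.2) ⟨(x, y), hm⟩ :=
      (continuous_snd.comp continuous_subtype_val).continuousAt
    have hφV : ∀ᶠ x' in 𝓝 x, φ x' ∈ V ∩ 𝓡.U m :=
      hφ ((hV.inter (𝓡.isOpen_U m)).mem_nhds (hφx ▸ ⟨hyV, hy⟩))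
    filter_upwards [h1 hφV, h1 hφr, h2 (hV.mem_nhds hyV)]
    rintro ⟨⟨x', y'⟩, hp⟩ ⟨ha, haU⟩ hb hc
    change (x', φ x') ∈ 𝓡.graph n at hb
    have hd : (φ x', y') ∈ 𝓡.graph m :=
      graph_trans (graph_symm (graph_of_le hnm hb haU)) hp
    have he : φ x' = y' := hinj _ ha _ hc hd
    change (x', y') ∈ 𝓡.graph n
    rwa [← he]

theorem continuous_incl (n : ℕ) : Continuous (𝓡.incl n) :=
  continuous_iSup_rng continuous_coinduced_rng

theorem continuous_of_incl {Z : Type*} [TopologicalSpace Z] {f : 𝓡.Arrows → Z}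
    (h : ∀ n, Continuous (f ∘ 𝓡.incl n)) : Continuous f := by
  refine ⟨fun s hs => (𝓡.isOpen_arrows_iff _).2 fun n => ?_⟩
  exact hs.preimage (h n)

theorem incl_injective (n : ℕ) : Function.Injective (𝓡.incl n) := by
  intro p q h
  exact Subtype.ext (congrArg (fun γ : 𝓡.Arrows => γ.1) h)

/-- The inductive limit topology does not alter the topology of `R n`, and `R n` is open in the
limit. Topological properties of the arrow space can then be checked on the `R n`. -/
theorem isOpenEmbedding_incl (n : ℕ) : IsOpenEmbedding (𝓡.incl n) := by
  refine IsOpenEmbedding.of_continuous_injective_isOpenMap (𝓡.continuous_incl n)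
    (𝓡.incl_injective n) fun V hV => (𝓡.isOpen_arrows_iff _).2 fun m => ?_
  obtain ⟨O, hO, rfl⟩ := isOpen_induced_iff.1 hV
  have : 𝓡.incl m ⁻¹' (𝓡.incl n '' ((↑) ⁻¹' O)) =
      {p : 𝓡.graph m | (p : X × X) ∈ 𝓡.graph n} ∩ (↑) ⁻¹' O := by
    ext p
    constructor
    · rintro ⟨q, hq, hqp⟩
      have hqp' : (q : X × X) = p := congrArg Subtype.val hqp
      exact ⟨show (p : X × X) ∈ _ from hqp' ▸ q.2, show (p : X × X) ∈ O from hqp' ▸ hq⟩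
    · rintro ⟨hp, hpO⟩
      exact ⟨⟨p, hp⟩, hpO, Subtype.ext rfl⟩
  rw [this]
  exact (𝓡.isOpen_graph_inter n m).inter (hO.preimage continuous_subtype_val)

/-- The set of arrows belonging to `R n`. -/
def arrowsOf (𝓡 : Gap X) (n : ℕ) : Set 𝓡.Arrows := {γ | γ.1 ∈ 𝓡.graph n}

theorem range_incl (n : ℕ) : Set.range (𝓡.incl n) = 𝓡.arrowsOf n := by
  ext γ
  constructor
  · rintro ⟨p, rfl⟩
    exact p.2
  · intro h
    exact ⟨⟨γ.1, h⟩, Subtype.ext rfl⟩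

theorem isOpen_arrowsOf (n : ℕ) : IsOpen (𝓡.arrowsOf n) :=
  𝓡.range_incl n ▸ (𝓡.isOpenEmbedding_incl n).isOpen_range

theorem iUnion_arrowsOf : ⋃ n, 𝓡.arrowsOf n = univ :=
  eq_univ_of_forall fun γ => mem_iUnion.2 γ.2

theorem continuous_arrows_val : Continuous fun γ : 𝓡.Arrows => γ.1 :=
  𝓡.continuous_of_incl fun _ => continuous_subtype_val

theorem continuous_range : Continuous (range (𝓡 := 𝓡)) :=
  continuous_fst.comp 𝓡.continuous_arrows_val

theorem continuous_source : Continuous (source (𝓡 := 𝓡)) :=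
  continuous_snd.comp 𝓡.continuous_arrows_val

instance [T2Space X] : T2Space 𝓡.Arrows :=
  T2Space.of_injective_continuous Subtype.val_injective 𝓡.continuous_arrows_val

instance [SecondCountableTopology X] : SecondCountableTopology 𝓡.Arrows := by
  have : ∀ n, SecondCountableTopology (𝓡.arrowsOf n) := fun n => by
    rw [← 𝓡.range_incl n]
    exact (𝓡.isOpenEmbedding_incl n).toIsEmbedding.toHomeomorph.symm.isEmbedding.secondCountableTopology
  exact secondCountableTopology_of_countable_cover 𝓡.isOpen_arrowsOf 𝓡.iUnion_arrowsOf

/-- A local section `x' ↦ (x', φ x')` of `R n` passes through the given arrow, so the image of a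
neighbourhood of the arrow contains all `x'` near `x`. -/
theorem isOpenMap_range : IsOpenMap (range (𝓡 := 𝓡)) := by
  rw [isOpenMap_iff_nhds_le]
  rintro ⟨⟨x, y⟩, n, hn⟩ s hs
  rw [mem_map] at hs
  have hs' : 𝓡.incl n ⁻¹' (range ⁻¹' s) ∈ 𝓝 (⟨(x, y), hn⟩ : 𝓡.graph n) :=
    (𝓡.continuous_incl n).continuousAt hs
  rw [nhds_induced, mem_comap] at hs'
  obtain ⟨O, hO, hOs⟩ := hs'
  obtain ⟨φ, hφ, hφx, hφr⟩ := 𝓡.exists_graph_section n hn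
  have h : ContinuousAt (fun x' => (x', φ x')) x := continuousAt_id.prodMk hφ
  have hO' : O ∈ 𝓝 (x, φ x) := by rwa [hφx]
  change s ∈ 𝓝 x
  filter_upwards [h hO', hφr] with x' h1 h2
  exact hOs (show (⟨(x', φ x'), h2⟩ : 𝓡.graph n) ∈ _ from h1)

theorem isLocalHomeomorph_range : IsLocalHomeomorph (range (𝓡 := 𝓡)) := by
  refine isLocalHomeomorph_of_isOpenMap 𝓡.continuous_range 𝓡.isOpenMap_range ?_
  rintro ⟨⟨x, y⟩, n, hn⟩
  obtain ⟨V, hV, hyV, hinj⟩ := 𝓡.exists_isOpen_graph_inj n hn.2.1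
  -- Two arrows of `R n` with the same range have `R n`-equivalent sources, and `V` contains at most
  -- one point of each class.
  refine ⟨𝓡.arrowsOf n ∩ source ⁻¹' V,
    (𝓡.isOpen_arrowsOf n).inter (hV.preimage 𝓡.continuous_source), ⟨hn, hyV⟩, ?_⟩
  rintro ⟨⟨x₁, y₁⟩, _⟩ ⟨h₁, hV₁⟩ ⟨⟨x₂, y₂⟩, _⟩ ⟨h₂, hV₂⟩ (rfl : x₁ = x₂)
  have : y₁ = y₂ := hinj _ hV₁ _ hV₂ (graph_trans (graph_symm h₁) h₂)
  subst this
  rfl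

/-- Inversion of arrows. -/
def inv (γ : 𝓡.Arrows) : 𝓡.Arrows := ⟨(γ.1.2, γ.1.1), γ.2.imp fun _ h => graph_symm h⟩

theorem continuous_inv : Continuous 𝓡.inv := by
  refine 𝓡.continuous_of_incl fun n => ?_
  have h : Continuous fun p : 𝓡.graph n => (⟨(p.1.2, p.1.1), graph_symm p.2⟩ : 𝓡.graph n) := by
    fun_prop
  exact (𝓡.continuous_incl n).comp h

/-- Inversion of arrows, as a homeomorphism. -/
def invHomeomorph : 𝓡.Arrows ≃ₜ 𝓡.Arrows where
  toFun := 𝓡.inv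
  invFun := 𝓡.inv
  left_inv _ := rfl
  right_inv _ := rfl
  continuous_toFun := 𝓡.continuous_inv
  continuous_invFun := 𝓡.continuous_inv

theorem isLocalHomeomorph_source : IsLocalHomeomorph (source (𝓡 := 𝓡)) :=
  𝓡.isLocalHomeomorph_range.comp 𝓡.invHomeomorph.isLocalHomeomorph

variable {𝓡}

/-- The membership proofs selected by `choose` inside `cn` are immaterial, by proof irrelevance. -/
theorem Potential.cn_apply (k : 𝓡.Potential) {n : ℕ} {x y : X} (h : (x, y) ∈ 𝓡.graph n)
    (hx : x ∈ 𝓡.U n) (hy : y ∈ 𝓡.U n) : k.cn n ⟨(x, y), h⟩ = k.h n ⟨x, hx⟩ - k.h n ⟨y, hy⟩ :=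
  rfl

theorem Potential.continuous_D (k : 𝓡.Potential) : Continuous k.D := by
  refine Real.continuous_exp.comp (𝓡.continuous_of_incl fun n => ?_)
  rw [show k.c ∘ 𝓡.incl n = k.cn n from funext (k.c_incl n)]
  refine .sub ((k.continuous_h n).comp ?_) ((k.continuous_h n).comp ?_)
  · exact (continuous_fst.comp continuous_subtype_val).subtype_mk _
  · exact (continuous_snd.comp continuous_subtype_val).subtype_mk _

theorem Potential.D_eq_div (k : 𝓡.Potential) {n : ℕ} (γ : 𝓡.Arrows) (hγ : γ.1 ∈ 𝓡.graph n)
    (hx : γ.1.1 ∈ 𝓡.U n) (hy : γ.1.2 ∈ 𝓡.U n) :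
    k.D γ = k.ρ n ⟨γ.1.1, hx⟩ / k.ρ n ⟨γ.1.2, hy⟩ := by
  have : k.c γ = k.cn n ⟨γ.1, hγ⟩ := k.c_incl n ⟨γ.1, hγ⟩
  rw [D, this, k.cn_apply hγ hx hy, Real.exp_sub]
  rfl

end Gap

/-! ### Integration along the fibers of a local homeomorphism -/

/-- The sum of a `[0,∞]`-valued function over the fibers of a map. -/
noncomputable def fiberSum {G X : Type*} (p : G → X) (F : G → ℝ≥0∞) (x : X) : ℝ≥0∞ :=
  ∑' γ : {γ : G // p γ = x}, F γ

theorem fiberSum_mono {G X : Type*} (p : G → X) {F F' : G → ℝ≥0∞} (h : ∀ γ, F γ ≤ F' γ) (x : X) :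
    fiberSum p F x ≤ fiberSum p F' x :=
  ENNReal.tsum_le_tsum fun γ => h γ

theorem fiberSum_tsum {G X : Type*} (p : G → X) (F : ℕ → G → ℝ≥0∞) :
    fiberSum p (fun γ => ∑' n, F n γ) = fun x => ∑' n, fiberSum p (F n) x := by
  funext x
  exact ENNReal.tsum_comm

/-- Summing over the fibers a function that vanishes outside of a set on which the map is
injective. -/
theorem fiberSum_eq_of_injOn {G X : Type*} {p : G → X} {V : Set G} (hV : InjOn p V)
    {F : G → ℝ≥0∞} (hF : ∀ γ, γ ∉ V → F γ = 0) {γ : G} (hγ : γ ∈ V) :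
    fiberSum p F (p γ) = F γ := by
  rw [fiberSum, tsum_eq_single ⟨γ, rfl⟩]
  rintro ⟨γ', hγ'⟩ hne
  refine hF _ fun h => hne ?_
  exact Subtype.ext (hV h hγ hγ')

theorem fiberSum_eq_zero_of_notMem_image {G X : Type*} {p : G → X} {V : Set G}
    {F : G → ℝ≥0∞} (hF : ∀ γ, γ ∉ V → F γ = 0) {x : X} (hx : x ∉ p '' V) :
    fiberSum p F x = 0 := by
  rw [fiberSum, ENNReal.tsum_eq_zero]
  rintro ⟨γ, rfl⟩
  exact hF _ fun h => hx ⟨γ, h, rfl⟩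

theorem fiberSum_indicator_one_le_one {G X : Type*} {p : G → X} {V : Set G} (hV : InjOn p V)
    (x : X) : fiberSum p (V.indicator fun _ => 1) x ≤ 1 := by
  have h0 : ∀ γ, γ ∉ V → V.indicator (fun _ => (1 : ℝ≥0∞)) γ = 0 :=
    fun γ h => indicator_of_notMem h _
  by_cases hx : x ∈ p '' V
  · obtain ⟨γ, hγ, rfl⟩ := hx
    rw [fiberSum_eq_of_injOn hV h0 hγ, indicator_of_mem hγ]
  · rw [fiberSum_eq_zero_of_notMem_image h0 hx]
    exact zero_le

section LocalHomeomorph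

variable {G X : Type*} [TopologicalSpace G] [TopologicalSpace X] {p : G → X}

/-- A compact set is covered by finitely many open sets on which `p` is injective, and each of them
meets a fiber at most once. -/
theorem exists_fiberSum_indicator_le (hp : IsLocalHomeomorph p) {K : Set G} (hK : IsCompact K) :
    ∃ N : ℕ, ∀ x, fiberSum p (K.indicator fun _ => 1) x ≤ N := by
  refine hK.induction_on (p := fun K : Set G => ∃ N : ℕ, ∀ x,
    fiberSum p (K.indicator fun _ => 1) x ≤ N) ?_ ?_ ?_ ?_
  · exact ⟨0, fun x => by simp [fiberSum]⟩
  · rintro s t hst ⟨N, hN⟩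
    exact ⟨N, fun x => (fiberSum_mono p
      (fun γ => indicator_le_indicator_of_subset hst (fun _ => zero_le) γ) x).trans (hN x)⟩
  · rintro s t ⟨N, hN⟩ ⟨M, hM⟩
    refine ⟨N + M, fun x => ?_⟩
    calc fiberSum p ((s ∪ t).indicator fun _ => 1) x
        ≤ fiberSum p (fun γ => s.indicator (fun _ => 1) γ + t.indicator (fun _ => 1) γ) x := by
          refine fiberSum_mono p (fun γ => ?_) x
          by_cases h₁ : γ ∈ s <;> by_cases h₂ : γ ∈ t <;> simp [h₁, h₂]
      _ = fiberSum p (s.indicator fun _ => 1) x + fiberSum p (t.indicator fun _ => 1) x :=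
          ENNReal.tsum_add
      _ ≤ ((N + M : ℕ) : ℝ≥0∞) := by
          push_cast
          exact add_le_add (hN x) (hM x)
  · intro γ _
    obtain ⟨V, hV, hγV, hinj⟩ := hp.exists_isOpen_injOn γ
    refine ⟨V, mem_nhdsWithin_of_mem_nhds (hV.mem_nhds hγV), 1, fun x => ?_⟩
    simpa using fiberSum_indicator_one_le_one hinj x

/-- Makes the real and complex fiber sums of `C_c` functions absolutely convergent, so that their
`tsum` is not the default value `0`. -/
theorem fiberSum_enorm_ne_top (hp : IsLocalHomeomorph p) {E : Type*} [NormedAddCommGroup E]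
    {f : G → E} (hf : Continuous f) (hc : HasCompactSupport f) (x : X) :
    fiberSum p (fun γ => ‖f γ‖ₑ) x ≠ ∞ := by
  obtain ⟨N, hN⟩ := exists_fiberSum_indicator_le hp hc
  obtain ⟨C, hC⟩ := hf.bounded_above_of_compact_support hc
  have h : ∀ γ, ‖f γ‖ₑ ≤ ENNReal.ofReal C * (tsupport f).indicator (fun _ => 1) γ := fun γ => by
    by_cases hγ : γ ∈ tsupport f
    · rw [indicator_of_mem hγ, mul_one, ← ofReal_norm]
      exact ENNReal.ofReal_le_ofReal (hC γ)
    · simp [image_eq_zero_of_notMem_tsupport hγ]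
  refine ne_top_of_le_ne_top ?_ (fiberSum_mono p h x)
  have : fiberSum p (fun γ => ENNReal.ofReal C * (tsupport f).indicator (fun _ => 1) γ) x =
      ENNReal.ofReal C * fiberSum p ((tsupport f).indicator fun _ => 1) x :=
    ENNReal.tsum_mul_left
  rw [this]
  exact ENNReal.mul_ne_top ENNReal.ofReal_ne_top 
    (ne_top_of_le_ne_top (ENNReal.natCast_ne_top N) (hN x))

theorem tsum_fiber_eq_toReal_sub {G X : Type*} {p : G → X} {g : G → ℝ} {x : X}
    (hfin : fiberSum p (fun γ => ‖g γ‖ₑ) x ≠ ∞) :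
    ∑' γ : {γ : G // p γ = x}, g γ =
      (fiberSum p (fun γ => ENNReal.ofReal (g γ)) x).toReal -
        (fiberSum p (fun γ => ENNReal.ofReal (-g γ)) x).toReal := by
  have h₁ : fiberSum p (fun γ => ENNReal.ofReal (g γ)) x ≠ ∞ :=
    ne_top_of_le_ne_top hfin (fiberSum_mono p (fun γ => Real.ofReal_le_enorm _) x)
  have h₂ : fiberSum p (fun γ => ENNReal.ofReal (-g γ)) x ≠ ∞ :=
    ne_top_of_le_ne_top hfin (fiberSum_mono p (fun γ => by
      simpa using Real.ofReal_le_enorm (-g γ)) x)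
  rw [fiberSum, fiberSum, ENNReal.tsum_toReal_eq fun _ => ENNReal.ofReal_ne_top,
    ENNReal.tsum_toReal_eq fun _ => ENNReal.ofReal_ne_top,
    ← (ENNReal.summable_toReal h₁).tsum_sub (ENNReal.summable_toReal h₂)]
  refine tsum_congr fun γ => ?_
  rw [ENNReal.toReal_ofReal', ENNReal.toReal_ofReal', max_zero_sub_max_neg_zero_eq_self]

variable [MeasurableSpace G] [BorelSpace G] [MeasurableSpace X] [BorelSpace X]

/-- Countably many chart domains cover `G`; made disjoint, they cut `F` into pieces that each live
on one chart. The fiber sum of a piece is that piece composed with the inverse chart on the open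
target, and zero elsewhere. -/
theorem measurable_fiberSum [SecondCountableTopology G] (hp : IsLocalHomeomorph p)
    {F : G → ℝ≥0∞} (hF : Measurable F) : Measurable (fiberSum p F) := by
  rcases isEmpty_or_nonempty G with hG | hG
  · have : fiberSum p F = fun _ => 0 := by
      funext x
      simp [fiberSum]
    rw [this]
    exact measurable_const
  choose e he hee using hp
  obtain ⟨s, hs, hcov⟩ :=
    TopologicalSpace.countable_cover_nhds fun γ => (e γ).open_source.mem_nhds (he γ)
  have hne : s.Nonempty := by
    by_contra h
    rw [not_nonempty_iff_eq_empty] at h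
    subst h
    simp only [mem_empty_iff_false, iUnion_of_empty, iUnion_empty] at hcov
    exact empty_ne_univ hcov
  obtain ⟨u, rfl⟩ := hs.exists_eq_range hne
  let W : ℕ → Set G := fun n => (e (u n)).source
  have hW : ∀ n, MeasurableSet (W n) := fun n => (e (u n)).open_source.measurableSet
  have hWu : ⋃ n, disjointed W n = univ := by
    rw [iUnion_disjointed, ← hcov]
    simp [W]
  have hsum : F = fun γ => ∑' n, (disjointed W n).indicator F γ := by
    funext γ
    rw [← indicator_iUnion_eq_tsum (disjoint_disjointed W) F γ, hWu, indicator_univ]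
  rw [hsum, fiberSum_tsum]
  refine Measurable.tsum fun n => ?_
  set g := (disjointed W n).indicator F with hg
  have hgm : Measurable g := hF.indicator (MeasurableSet.disjointed hW n)
  have hg0 : ∀ γ, γ ∉ (e (u n)).source → g γ = 0 := fun γ hγ =>
    indicator_of_notMem (fun h => hγ (disjointed_subset W n h)) F
  have hinj : InjOn p (e (u n)).source := by
    conv in p => rw [hee (u n)]
    exact (e (u n)).injOn
  refine measurable_of_restrict_of_restrict_compl (e (u n)).open_target.measurableSet ?_ ?_
  · have h : (e (u n)).target.domRestrict (fiberSum p g) =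
        fun x : (e (u n)).target => g ((e (u n)).symm x) := by
      funext ⟨x, hx⟩
      have hpx : p ((e (u n)).symm x) = x := by
        conv_lhs => rw [hee (u n)]
        exact (e (u n)).right_inv hx
      have := fiberSum_eq_of_injOn hinj hg0 ((e (u n)).map_target hx)
      rwa [hpx] at this
    rw [h]
    apply hgm.comp
    apply Continuous.measurable
    exact (e (u n)).continuousOn_symm.comp_continuous continuous_subtype_val fun x => x.2
  · have h : (e (u n)).targetᶜ.domRestrict (fiberSum p g) = fun _ => 0 := by
      funext ⟨x, hx⟩
      refine fiberSum_eq_zero_of_notMem_image hg0 ?_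
      rintro ⟨γ, hγ, rfl⟩
      apply hx
      have := (e (u n)).map_source hγ
      rwa [← hee (u n)] at this
    rw [h]
    exact measurable_const

theorem sigmaAdditive_fiberSum [SecondCountableTopology G] (hp : IsLocalHomeomorph p) :
    SigmaAdditive (fiberSum p) where
  measurable _ hF := measurable_fiberSum hp hF
  const_mul c F _ := by
    funext x
    simp only [fiberSum, ENNReal.tsum_mul_left]
  tsum F _ := fiberSum_tsum p F

/-- The measure `F ↦ ∫ ∑_{p(γ) = x} F(γ) dμ(x)` obtained by integrating the counting measures of
the fibers of a local homeomorphism. -/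
noncomputable def IsLocalHomeomorph.fiberMeasure [SecondCountableTopology G]
    (hp : IsLocalHomeomorph p) (μ : Measure X) : Measure G :=
  (sigmaAdditive_fiberSum hp).dual μ

variable [SecondCountableTopology G] (hp : IsLocalHomeomorph p) (μ : Measure X)

theorem lintegral_fiberMeasure {F : G → ℝ≥0∞} (hF : Measurable F) :
    ∫⁻ γ, F γ ∂(hp.fiberMeasure μ) = ∫⁻ x, fiberSum p F x ∂μ :=
  (sigmaAdditive_fiberSum hp).lintegral_dual μ hF

instance [T2Space G] [IsFiniteMeasure μ] : IsFiniteMeasureOnCompacts (hp.fiberMeasure μ) where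
  lt_top_of_isCompact K hK := by
    obtain ⟨N, hN⟩ := exists_fiberSum_indicator_le hp hK
    rw [IsLocalHomeomorph.fiberMeasure, SigmaAdditive.dual_apply _ _ hK.measurableSet]
    calc ∫⁻ x, fiberSum p (K.indicator fun _ => 1) x ∂μ ≤ ∫⁻ _, (N : ℝ≥0∞) ∂μ :=
          lintegral_mono hN
      _ < ∞ := by
          rw [lintegral_const]
          exact ENNReal.mul_lt_top (ENNReal.natCast_lt_top N) (measure_lt_top μ _)

/-- The defining identity of `fiberMeasure` concerns `[0,∞]`-valued functions; it is applied to the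
positive and negative parts separately, finiteness allowing the subtraction. -/
theorem integral_tsum_fiber_real {g : G → ℝ} (hg : Integrable g (hp.fiberMeasure μ))
    (hgm : Measurable g) (hfin : ∀ x, fiberSum p (fun γ => ‖g γ‖ₑ) x ≠ ∞) :
    Integrable (fun x => ∑' γ : {γ : G // p γ = x}, g γ) μ ∧
      ∫ x, ∑' γ : {γ : G // p γ = x}, g γ ∂μ = ∫ γ, g γ ∂(hp.fiberMeasure μ) := by
  have key : ∀ g : G → ℝ, Integrable g (hp.fiberMeasure μ) → Measurable g →
      (∀ x, fiberSum p (fun γ => ‖g γ‖ₑ) x ≠ ∞) →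
      Measurable (fiberSum p fun γ => ENNReal.ofReal (g γ)) ∧
      ∫⁻ x, fiberSum p (fun γ => ENNReal.ofReal (g γ)) x ∂μ ≠ ∞ ∧
      ∫ x, (fiberSum p (fun γ => ENNReal.ofReal (g γ)) x).toReal ∂μ =
        (∫⁻ γ, ENNReal.ofReal (g γ) ∂(hp.fiberMeasure μ)).toReal := by
    intro g hg hgm hfin
    have hm : Measurable (fiberSum p fun γ => ENNReal.ofReal (g γ)) :=
      measurable_fiberSum hp hgm.ennreal_ofReal
    refine ⟨hm, ?_, ?_⟩
    · rw [← lintegral_fiberMeasure hp μ hgm.ennreal_ofReal]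
      exact ne_top_of_le_ne_top hg.2.ne (lintegral_mono fun γ => Real.ofReal_le_enorm _)
    · rw [integral_toReal hm.aemeasurable, lintegral_fiberMeasure hp μ hgm.ennreal_ofReal]
      exact .of_forall fun x => lt_top_iff_ne_top.2
        (ne_top_of_le_ne_top (hfin x) (fiberSum_mono p (fun γ => Real.ofReal_le_enorm _) x))
  obtain ⟨m₁, f₁, e₁⟩ := key g hg hgm hfin
  obtain ⟨m₂, f₂, e₂⟩ := key (fun γ => -g γ) hg.neg hgm.neg fun x => by simpa using hfin x
  have i₁ := integrable_toReal_of_lintegral_ne_top m₁.aemeasurable f₁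
  have i₂ := integrable_toReal_of_lintegral_ne_top m₂.aemeasurable f₂
  simp only [tsum_fiber_eq_toReal_sub (hfin _)]
  refine ⟨i₁.sub i₂, ?_⟩
  rw [integral_sub i₁ i₂, e₁, e₂, integral_eq_lintegral_pos_part_sub_lintegral_neg_part hg]

theorem integral_tsum_fiber [T2Space G] [IsFiniteMeasure μ] {f : G → ℂ} (hf : Continuous f)
    (hc : HasCompactSupport f) :
    ∫ x, ∑' γ : {γ : G // p γ = x}, f γ ∂μ = ∫ γ, f γ ∂(hp.fiberMeasure μ) := by
  have hi : Integrable f (hp.fiberMeasure μ) := hf.integrable_of_hasCompactSupport hc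
  have hre : ∀ x, fiberSum p (fun γ => ‖(f γ).re‖ₑ) x ≠ ∞ :=
    fiberSum_enorm_ne_top hp (Complex.continuous_re.comp hf) (hc.comp_left Complex.zero_re)
  have him : ∀ x, fiberSum p (fun γ => ‖(f γ).im‖ₑ) x ≠ ∞ :=
    fiberSum_enorm_ne_top hp (Complex.continuous_im.comp hf) (hc.comp_left Complex.zero_im)
  obtain ⟨i₁, e₁⟩ := integral_tsum_fiber_real hp μ (g := fun γ => (f γ).re) hi.re
    (Complex.continuous_re.comp hf).measurable hre
  obtain ⟨i₂, e₂⟩ := integral_tsum_fiber_real hp μ (g := fun γ => (f γ).im) hi.im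
    (Complex.continuous_im.comp hf).measurable him
  have hs : ∀ x, ∑' γ : {γ : G // p γ = x}, f γ =
      ((∑' γ : {γ : G // p γ = x}, (f γ).re : ℝ) : ℂ) +
        ((∑' γ : {γ : G // p γ = x}, (f γ).im : ℝ) : ℂ) * Complex.I := fun x => by
    have hsum : Summable fun γ : {γ : G // p γ = x} => f γ := by
      refine Summable.of_enorm ?_
      exact fiberSum_enorm_ne_top hp hf hc x
    rw [← Complex.re_tsum hsum, ← Complex.im_tsum hsum, Complex.re_add_im]
  simp only [hs]
  rw [integral_add i₁.ofReal (i₂.ofReal.mul_const _), integral_mul_const,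
    integral_complex_ofReal, integral_complex_ofReal, e₁, e₂]
  exact integral_re_add_im hi

end LocalHomeomorph

/-! ### From compactly supported functions to Borel functions -/

/-- Quasi-invariance, tested on Borel functions instead of continuous functions with compact
support. -/
theorem isQuasiInvariant_iff_lintegral {G X : Type*} [TopologicalSpace G] [TopologicalSpace X]
    [T2Space G] [LocallyCompactSpace G] [SecondCountableTopology G] [MeasurableSpace G]
    [BorelSpace G] [MeasurableSpace X] [BorelSpace X] {r s : G → X}
    (hr : IsLocalHomeomorph r) (hs : IsLocalHomeomorph s) {D : G → ℝ} (hD : Continuous D)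
    (hD0 : ∀ γ, 0 ≤ D γ) (μ : Measure X) [IsFiniteMeasure μ] :
    IsQuasiInvariant r s D μ ↔ ∀ F : G → ℝ≥0∞, Measurable F →
      ∫⁻ x, fiberSum r F x ∂μ = ∫⁻ x, fiberSum s (fun γ => F γ * ENNReal.ofReal (D γ)) x ∂μ := by
  -- The measure on arrows behind the right-hand side; the one behind the left-hand side is
  -- `hr.fiberMeasure μ`.
  set ν : Measure G := (hs.fiberMeasure μ).withDensity fun γ => ENNReal.ofReal (D γ) with hν
  have hDm : Measurable fun γ => ENNReal.ofReal (D γ) := hD.measurable.ennreal_ofReal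
  have hνF : ∀ F : G → ℝ≥0∞, Measurable F →
      ∫⁻ γ, F γ ∂ν = ∫⁻ x, fiberSum s (fun γ => F γ * ENNReal.ofReal (D γ)) x ∂μ := by
    intro F hF
    rw [hν, lintegral_withDensity_eq_lintegral_mul _ hDm hF,
      ← lintegral_fiberMeasure hs μ (F := fun γ => F γ * ENNReal.ofReal (D γ)) (hF.mul hDm)]
    simp only [Pi.mul_apply, mul_comm]
  have hνf : ∀ f : G → ℂ, ∫ γ, f γ ∂ν = ∫ γ, f γ * D γ ∂(hs.fiberMeasure μ) := by
    intro f
    rw [hν, integral_withDensity_eq_integral_toReal_smul hDm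
      (.of_forall fun γ => ENNReal.ofReal_lt_top)]
    simp only [ENNReal.toReal_ofReal (hD0 _), Complex.real_smul, mul_comm]
  have : IsFiniteMeasureOnCompacts ν := ⟨fun K hK => by
    rw [hν, withDensity_apply _ hK.measurableSet]
    obtain ⟨C, hC⟩ := hK.exists_bound_of_continuousOn hD.continuousOn
    calc ∫⁻ γ in K, ENNReal.ofReal (D γ) ∂(hs.fiberMeasure μ)
        ≤ ∫⁻ γ in K, ENNReal.ofReal C ∂(hs.fiberMeasure μ) :=
          setLIntegral_mono measurable_const fun γ hγ =>
            ENNReal.ofReal_le_ofReal ((le_abs_self _).trans (hC γ hγ))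
      _ < ∞ := by
          rw [setLIntegral_const]
          exact ENNReal.mul_lt_top ENNReal.ofReal_lt_top hK.measure_lt_top⟩
  have hext : (∀ F : G → ℝ≥0∞, Measurable F →
      ∫⁻ x, fiberSum r F x ∂μ = ∫⁻ x, fiberSum s (fun γ => F γ * ENNReal.ofReal (D γ)) x ∂μ) ↔
      hr.fiberMeasure μ = ν := by
    constructor
    · intro h
      refine Measure.ext_of_lintegral _ fun F hF => ?_
      rw [hνF F hF, ← h F hF, lintegral_fiberMeasure hr μ hF]
    · intro h F hF
      rw [← hνF F hF, ← h, lintegral_fiberMeasure hr μ hF]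
  rw [hext]
  have hcD : ∀ f : G → ℂ, Continuous f → HasCompactSupport f →
      ∫ x, ∑' γ : {γ : G // s γ = x}, f γ * D γ ∂μ = ∫ γ, f γ ∂ν := by
    intro f hf hc
    rw [hνf]
    exact integral_tsum_fiber hs μ (hf.mul (Complex.continuous_ofReal.comp hD)) hc.mul_right
  constructor
  · intro h
    -- Uniqueness in the Riesz representation theorem: both measures are finite on compacts, and
    -- real test functions suffice.
    refine Measure.ext_of_integral_eq_on_compactlySupported fun g => ?_
    have hgc : Continuous fun γ => (g γ : ℂ) := Complex.continuous_ofReal.comp g.continuous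
    have hgs : HasCompactSupport fun γ => (g γ : ℂ) :=
      g.hasCompactSupport.comp_left Complex.ofReal_zero
    have := h _ hgc hgs
    rw [integral_tsum_fiber hr μ hgc hgs, hcD _ hgc hgs, integral_complex_ofReal,
      integral_complex_ofReal] at this
    exact Complex.ofReal_injective this
  · intro h f hf hc
    rw [integral_tsum_fiber hr μ hf hc, hcD f hf hc, h]

/-! ### A single proper relation -/

theorem classSum_eq_of_rel {Y : Type*} {r : Setoid Y} (f : Y → ℝ≥0∞) {x z : Y} (h : r x z) :
    classSum r f x = classSum r f z :=
  (Equiv.subtypeEquivRight fun _ => ⟨fun hy => r.trans (r.symm h) hy, fun hy => r.trans h hy⟩ :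
    {y : Y // r x y} ≃ {y : Y // r z y}).tsum_eq (fun y => f y)

theorem classSum_congr {Y : Type*} {r : Setoid Y} {f g : Y → ℝ≥0∞} {x : Y}
    (h : ∀ y, r x y → f y = g y) : classSum r f x = classSum r g x :=
  tsum_congr fun y => h y y.2

theorem classSum_mul_right {Y : Type*} (r : Setoid Y) (f : Y → ℝ≥0∞) (c : ℝ≥0∞) (x : Y) :
    classSum r (fun y => f y * c) x = classSum r f x * c :=
  ENNReal.tsum_mul_right

/-- `P_ρ` takes the same value on the two functions obtained by summing a kernel over its second
variable, respectively over its first variable with weights `ρ(z) / ρ(y)`. -/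
theorem condOp_classSum_kernel {Y : Type*} (r : Setoid Y) {ρ : Y → ℝ} (hρ : ∀ y, 0 < ρ y)
    (K : Y → Y → ℝ≥0∞) :
    condOp r ρ (fun z => classSum r (K z) z) =
      condOp r ρ fun y => classSum r (fun z => K z y * ENNReal.ofReal (ρ z / ρ y)) y := by
  funext x
  have hζ : ∀ {z}, r x z → partitionFunction r ρ x = partitionFunction r ρ z :=
    fun h => classSum_eq_of_rel _ h
  -- Since `ζ` is constant on the class of `x`, both sides are the double sum of `K z y * ρ z / ζ x`
  -- over this class, in opposite orders. Where `ζ = ∞` both vanish, so no finiteness is needed.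
  have h₁ : condOp r ρ (fun z => classSum r (K z) z) x = classSum r (fun z => classSum r
      (fun y => K z y * (ENNReal.ofReal (ρ z) * (partitionFunction r ρ x)⁻¹)) x) x := by
    refine classSum_congr fun z hz => ?_
    beta_reduce
    rw [classSum_mul_right, ← classSum_eq_of_rel (K z) hz, mul_assoc, ← hζ hz]
  have h₂ : condOp r ρ (fun y => classSum r (fun z => K z y * ENNReal.ofReal (ρ z / ρ y)) y) x =
      classSum r (fun y => classSum r
        (fun z => K z y * (ENNReal.ofReal (ρ z) * (partitionFunction r ρ x)⁻¹)) x) x := by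
    refine classSum_congr fun y hy => ?_
    beta_reduce
    rw [← classSum_eq_of_rel (fun z => K z y * ENNReal.ofReal (ρ z / ρ y)) hy, mul_assoc,
      ← classSum_mul_right, ← hζ hy]
    refine classSum_congr fun z _ => ?_
    have : ENNReal.ofReal (ρ z / ρ y) * ENNReal.ofReal (ρ y) = ENNReal.ofReal (ρ z) := by
      rw [← ENNReal.ofReal_mul (div_pos (hρ z) (hρ y)).le, div_mul_cancel₀ _ (hρ y).ne']
    rw [← this]
    ring
  rw [h₁, h₂]
  exact ENNReal.tsum_comm

/-- Evaluates the source side of quasi-invariance on kernels that depend only on the second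
variable. -/
theorem classSum_mul_div {Y : Type*} (r : Setoid Y) {ρ : Y → ℝ} (hρ : ∀ y, 0 < ρ y) (c : ℝ≥0∞)
    (y : Y) : classSum r (fun z => c * ENNReal.ofReal (ρ z / ρ y)) y =
      c * (ENNReal.ofReal (ρ y))⁻¹ * partitionFunction r ρ y := by
  rw [partitionFunction, mul_comm, ← classSum_mul_right]
  refine classSum_congr fun z _ => ?_
  rw [ENNReal.ofReal_div_of_pos (hρ y), div_eq_mul_inv]
  ring

section

variable {Y : Type*} [TopologicalSpace Y] [SecondCountableTopology Y] [MeasurableSpace Y]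
  [BorelSpace Y] {r : Setoid Y} {ρ : Y → ℝ} {ν : Measure Y}

theorem measurable_partitionFunction (hr : IsProperRel r) (hc : Continuous ρ) :
    Measurable (partitionFunction r ρ) :=
  measurable_classSum hr hc.measurable.ennreal_ofReal

/-- A finite measure that is quasi-invariant under a proper equivalence relation does not charge
the set where the partition function is infinite. -/
theorem measure_partitionFunction_eq_top [IsFiniteMeasure ν] (hr : IsProperRel r)
    (hρ : ∀ y, 0 < ρ y) (hc : Continuous ρ)
    (H : ∀ w : Y → ℝ≥0∞, Measurable w → ∫⁻ x, classSum r w x ∂ν =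
      ∫⁻ y, classSum r (fun z => w y * ENNReal.ofReal (ρ z / ρ y)) y ∂ν) :
    ν {y | partitionFunction r ρ y = ∞} = 0 := by
  have hA : MeasurableSet {y | partitionFunction r ρ y = ∞} :=
    measurable_partitionFunction hr hc (measurableSet_singleton ∞)
  refine measure_null_of_locally_null _ fun y _ => ?_
  obtain ⟨V, hV, hyV, hinj⟩ := hr.exists_isOpen_injOn y
  -- `B` meets each class at most once, so for the weight `1_B` the range side of `H` is at most `ν
  -- univ`. The source side is `∞ * ν B`, which forces `ν B = 0`.
  set B := V ∩ {y | partitionFunction r ρ y = ∞} with hB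
  have hBm : MeasurableSet B := hV.measurableSet.inter hA
  refine ⟨B, Filter.inter_mem (mem_nhdsWithin_of_mem_nhds (hV.mem_nhds hyV))
    self_mem_nhdsWithin, ?_⟩
  have h := H (B.indicator fun _ => 1) (measurable_const.indicator hBm)
  have hle : ∀ x, classSum r (B.indicator fun _ => 1) x ≤ 1 := by
    intro x
    by_cases hx : ∃ y ∈ B, r x y
    · obtain ⟨y, hy, hxy⟩ := hx
      rw [classSum, tsum_eq_single ⟨y, hxy⟩]
      · exact indicator_le_self' (fun _ _ => zero_le) _
      · rintro ⟨z, hz⟩ hne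
        refine indicator_of_notMem (fun hzB => hne (Subtype.ext ?_)) _
        exact hinj z hzB.1 y hy.1 (r.trans (r.symm hz) hxy)
    · rw [classSum, ENNReal.tsum_eq_zero.2]
      · exact zero_le
      · exact fun z => indicator_of_notMem (fun hz => hx ⟨z, hz, z.2⟩) _
  have hfin : ∫⁻ x, classSum r (B.indicator fun _ => 1) x ∂ν ≠ ∞ := by
    refine ne_top_of_le_ne_top (measure_ne_top ν univ) ?_
    calc _ ≤ ∫⁻ _, 1 ∂ν := lintegral_mono hle
      _ = ν univ := lintegral_one
  have htop : ∫⁻ y, classSum r (fun z => B.indicator (fun _ => 1) y * ENNReal.ofReal (ρ z / ρ y)) y ∂ν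
      = ∞ * ν B := by
    rw [← lintegral_indicator_const hBm]
    refine lintegral_congr fun y => ?_
    rw [classSum_mul_div r hρ]
    by_cases hy : y ∈ B
    · rw [indicator_of_mem hy, indicator_of_mem hy, show partitionFunction r ρ y = ∞ from hy.2,
        one_mul, ENNReal.mul_top]
      exact ENNReal.inv_ne_zero.2 ENNReal.ofReal_ne_top
    · simp [indicator_of_notMem hy]
  rw [h, htop] at hfin
  by_contra h0
  exact hfin (ENNReal.top_mul h0)

/-- A finite quasi-invariant measure is fixed by `P_ρ^*`. -/
theorem dual_condOp_eq_self [IsFiniteMeasure ν] (hr : IsProperRel r)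
    (hρ : ∀ y, 0 < ρ y) (hc : Continuous ρ)
    (H : ∀ w : Y → ℝ≥0∞, Measurable w → ∫⁻ x, classSum r w x ∂ν =
      ∫⁻ y, classSum r (fun z => w y * ENNReal.ofReal (ρ z / ρ y)) y ∂ν) :
    (sigmaAdditive_condOp hr hc).dual ν = ν := by
  refine Measure.ext_of_lintegral _ fun f hf => ?_
  rw [SigmaAdditive.lintegral_dual _ _ hf]
  have hζ := measurable_partitionFunction hr hc
  -- With this weight the left side of `H` is the integral of `P_ρ(f)`, and the right integrand `w ζ
  -- / ρ` reduces to `f` wherever `ζ` is finite.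
  have hw : Measurable fun y => f y * ENNReal.ofReal (ρ y) * (partitionFunction r ρ y)⁻¹ :=
    (hf.mul hc.measurable.ennreal_ofReal).mul hζ.inv
  rw [condOp, H _ hw]
  have hae : ∀ᵐ y ∂ν, partitionFunction r ρ y ≠ ∞ := by
    simpa [ae_iff] using measure_partitionFunction_eq_top hr hρ hc H
  refine lintegral_congr_ae ?_
  filter_upwards [hae] with y hy
  have hy0 : partitionFunction r ρ y ≠ 0 := by
    intro h0
    have := ENNReal.tsum_eq_zero.1 h0 ⟨y, r.refl y⟩
    exact (ENNReal.ofReal_pos.2 (hρ y)).ne' this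
  have hρ0 : ENNReal.ofReal (ρ y) ≠ 0 := (ENNReal.ofReal_pos.2 (hρ y)).ne'
  rw [classSum_mul_div r hρ]
  calc f y * ENNReal.ofReal (ρ y) * (partitionFunction r ρ y)⁻¹ * (ENNReal.ofReal (ρ y))⁻¹ *
        partitionFunction r ρ y
      = f y * (ENNReal.ofReal (ρ y) * (ENNReal.ofReal (ρ y))⁻¹) *
        ((partitionFunction r ρ y)⁻¹ * partitionFunction r ρ y) := by ring
    _ = f y := by
      rw [ENNReal.mul_inv_cancel hρ0 ENNReal.ofReal_ne_top, ENNReal.inv_mul_cancel hy0 hy,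
        mul_one, mul_one]

/-- A measure fixed by `P_ρ^*` is quasi-invariant. -/
theorem lintegral_classSum_kernel_of_dual_eq (hr : IsProperRel r) (hρ : ∀ y, 0 < ρ y)
    (hc : Continuous ρ) (h : (sigmaAdditive_condOp hr hc).dual ν = ν) {K : Y → Y → ℝ≥0∞}
    (ha : Measurable fun x => classSum r (K x) x)
    (hb : Measurable fun y => classSum r (fun z => K z y * ENNReal.ofReal (ρ z / ρ y)) y) :
    ∫⁻ x, classSum r (K x) x ∂ν =
      ∫⁻ y, classSum r (fun z => K z y * ENNReal.ofReal (ρ z / ρ y)) y ∂ν := by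
  conv_lhs => rw [← h]
  conv_rhs => rw [← h]
  rw [SigmaAdditive.lintegral_dual _ _ ha, SigmaAdditive.lintegral_dual _ _ hb,
    condOp_classSum_kernel r hρ]

end

/-! ### Restricting fiber sums from the arrow space to `R n` -/

namespace Gap

variable {X : Type*} [TopologicalSpace X] {𝓡 : Gap X}

open Classical in
/-- The restriction to `R n` of a function on arrows, as a kernel on `U n` vanishing outside
of `R n`. -/
noncomputable def kernel (n : ℕ) (F : 𝓡.Arrows → ℝ≥0∞) (x y : 𝓡.U n) : ℝ≥0∞ :=
  if h : 𝓡.R n x y then F (𝓡.incl n ⟨(x, y), x.2, y.2, h⟩) else 0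

/-- The arrows of `R n` with range `x` correspond to the `R n`-class of `x` through their source.
All other arrows in the fiber contribute zero. -/
theorem fiberSum_range_indicator (n : ℕ) (F : 𝓡.Arrows → ℝ≥0∞) (x : 𝓡.U n) :
    fiberSum range ((𝓡.arrowsOf n).indicator F) x = classSum (𝓡.R n) (kernel n F x) x := by
  let i : {y : 𝓡.U n // 𝓡.R n x y} → {γ : 𝓡.Arrows // range γ = x} :=
    fun y => ⟨𝓡.incl n ⟨(x, y.1), x.2, y.1.2, y.2⟩, rfl⟩
  have hi : Function.Injective i := fun y z h =>
    Subtype.ext (Subtype.ext (congrArg (fun γ : {γ : 𝓡.Arrows // range γ = _} => source γ.1) h))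
  rw [fiberSum, ← hi.tsum_eq (f := fun γ => (𝓡.arrowsOf n).indicator F γ), classSum]
  · refine tsum_congr fun y => ?_
    rw [kernel, dif_pos y.2]
    exact indicator_of_mem (show _ ∈ 𝓡.arrowsOf n from ⟨x.2, y.1.2, y.2⟩) F
  · rintro ⟨⟨⟨x', y⟩, hγ⟩, hx'⟩ hne
    obtain ⟨_, hy, h⟩ : (x', y) ∈ 𝓡.graph n :=
      mem_of_indicator_ne_zero (s := 𝓡.arrowsOf n) (f := F) hne
    obtain rfl : x' = x := hx'
    exact ⟨⟨⟨y, hy⟩, h⟩, rfl⟩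

theorem fiberSum_source_indicator (n : ℕ) (F : 𝓡.Arrows → ℝ≥0∞) (y : 𝓡.U n) :
    fiberSum source ((𝓡.arrowsOf n).indicator F) y =
      classSum (𝓡.R n) (fun z => kernel n F z y) y := by
  let i : {z : 𝓡.U n // 𝓡.R n y z} → {γ : 𝓡.Arrows // source γ = y} :=
    fun z => ⟨𝓡.incl n ⟨(z.1, y), z.1.2, y.2, (𝓡.R n).symm z.2⟩, rfl⟩
  have hi : Function.Injective i := fun z w h =>
    Subtype.ext (Subtype.ext (congrArg (fun γ : {γ : 𝓡.Arrows // source γ = _} => range γ.1) h))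
  rw [fiberSum, ← hi.tsum_eq (f := fun γ => (𝓡.arrowsOf n).indicator F γ), classSum]
  · refine tsum_congr fun z => ?_
    rw [kernel, dif_pos ((𝓡.R n).symm z.2)]
    exact indicator_of_mem (show _ ∈ 𝓡.arrowsOf n from ⟨z.1.2, y.2, (𝓡.R n).symm z.2⟩) F
  · rintro ⟨⟨⟨x, y'⟩, hγ⟩, hy'⟩ hne
    obtain ⟨hx, _, h⟩ : (x, y') ∈ 𝓡.graph n :=
      mem_of_indicator_ne_zero (s := 𝓡.arrowsOf n) (f := F) hne
    obtain rfl : y' = y := hy'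
    exact ⟨⟨⟨x, hx⟩, (𝓡.R n).symm h⟩, rfl⟩

theorem fiberSum_range_indicator_of_notMem {n : ℕ} (F : 𝓡.Arrows → ℝ≥0∞) {x : X}
    (hx : x ∉ 𝓡.U n) : fiberSum range ((𝓡.arrowsOf n).indicator F) x = 0 := by
  refine fiberSum_eq_zero_of_notMem_image (fun _ h => indicator_of_notMem h F) ?_
  rintro ⟨γ, hγ, rfl⟩
  exact hx hγ.1

theorem fiberSum_source_indicator_of_notMem {n : ℕ} (F : 𝓡.Arrows → ℝ≥0∞) {y : X}
    (hy : y ∉ 𝓡.U n) : fiberSum source ((𝓡.arrowsOf n).indicator F) y = 0 := by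
  refine fiberSum_eq_zero_of_notMem_image (fun _ h => indicator_of_notMem h F) ?_
  rintro ⟨γ, hγ, rfl⟩
  exact hy hγ.2.1

theorem Potential.ρ_pos (k : 𝓡.Potential) (n : ℕ) (x : 𝓡.U n) : 0 < k.ρ n x :=
  Real.exp_pos _

theorem kernel_mul_D (k : 𝓡.Potential) (n : ℕ) (F : 𝓡.Arrows → ℝ≥0∞) (z y : 𝓡.U n) :
    kernel n (fun γ => F γ * ENNReal.ofReal (k.D γ)) z y =
      kernel n F z y * ENNReal.ofReal (k.ρ n z / k.ρ n y) := by
  by_cases h : 𝓡.R n z y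
  · rw [kernel, kernel, dif_pos h, dif_pos h,
      k.D_eq_div (𝓡.incl n ⟨(z, y), z.2, y.2, h⟩) ⟨z.2, y.2, h⟩ z.2 y.2]
    rfl
  · rw [kernel, kernel, dif_neg h, dif_neg h, zero_mul]

theorem lintegral_eq_lintegral_comap [MeasurableSpace X] [OpensMeasurableSpace X] (n : ℕ)
    (μ : Measure X) {g : X → ℝ≥0∞} (hg : ∀ x, x ∉ 𝓡.U n → g x = 0) :
    ∫⁻ x, g x ∂μ = ∫⁻ x : 𝓡.U n, g x ∂(μ.comap ((↑) : 𝓡.U n → X)) := by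
  have hU : MeasurableSet (𝓡.U n) := (𝓡.isOpen_U n).measurableSet
  rw [lintegral_subtype_comap hU, ← lintegral_indicator hU]
  refine lintegral_congr fun x => ?_
  by_cases hx : x ∈ 𝓡.U n
  · rw [indicator_of_mem hx]
  · rw [indicator_of_notMem hx, hg x hx]

theorem indicator_mul_D (k : 𝓡.Potential) (n : ℕ) (F : 𝓡.Arrows → ℝ≥0∞) :
    (fun γ => (𝓡.arrowsOf n).indicator F γ * ENNReal.ofReal (k.D γ)) =
      (𝓡.arrowsOf n).indicator fun γ => F γ * ENNReal.ofReal (k.D γ) :=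
  funext fun _ => (indicator_mul_left _ F fun γ => ENNReal.ofReal (k.D γ)).symm

theorem fiberSum_source_indicator_mul_D (k : 𝓡.Potential) (n : ℕ) (F : 𝓡.Arrows → ℝ≥0∞)
    (y : 𝓡.U n) :
    fiberSum source (fun γ => (𝓡.arrowsOf n).indicator F γ * ENNReal.ofReal (k.D γ)) y =
      classSum (𝓡.R n)
        (fun z => kernel n F z y * ENNReal.ofReal (k.ρ n z / k.ρ n y)) y := by
  simp only [indicator_mul_D, ← kernel_mul_D]
  exact fiberSum_source_indicator n _ y

variable [MeasurableSpace X] [OpensMeasurableSpace X]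

theorem lintegral_fiberSum_range (n : ℕ) (μ : Measure X) (F : 𝓡.Arrows → ℝ≥0∞) :
    ∫⁻ x, fiberSum range ((𝓡.arrowsOf n).indicator F) x ∂μ =
      ∫⁻ x, classSum (𝓡.R n) (kernel n F x) x ∂(μ.comap ((↑) : 𝓡.U n → X)) := by
  rw [lintegral_eq_lintegral_comap n μ fun x hx => fiberSum_range_indicator_of_notMem F hx]
  simp only [fiberSum_range_indicator]

theorem lintegral_fiberSum_source (k : 𝓡.Potential) (n : ℕ) (μ : Measure X)
    (F : 𝓡.Arrows → ℝ≥0∞) :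
    ∫⁻ y, fiberSum source
        (fun γ => (𝓡.arrowsOf n).indicator F γ * ENNReal.ofReal (k.D γ)) y ∂μ =
      ∫⁻ y, classSum (𝓡.R n)
        (fun z => kernel n F z y * ENNReal.ofReal (k.ρ n z / k.ρ n y)) y
          ∂(μ.comap ((↑) : 𝓡.U n → X)) := by
  refine (lintegral_eq_lintegral_comap n μ fun y hy => ?_).trans
    (lintegral_congr fun y => fiberSum_source_indicator_mul_D k n F y)
  rw [indicator_mul_D]
  exact fiberSum_source_indicator_of_notMem _ hy

end Gap

/-! ### The equivalence -/

theorem corollary6p8 {X : Type*} [TopologicalSpace X] [LocallyCompactSpace X]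
    [SecondCountableTopology X] [MetrizableSpace X] [MeasurableSpace X] [BorelSpace X]
    (𝓡 : Gap X) (k : 𝓡.Potential) (μ : Measure X) [IsFiniteMeasure μ] :
    IsQuasiInvariant (Gap.range (𝓡 := 𝓡)) Gap.source k.D μ ↔
      ∀ n : ℕ, k.dualCondOp n (μ.comap ((↑) : 𝓡.U n → X)) = μ.comap ((↑) : 𝓡.U n → X) := by
  have hlc : LocallyCompactSpace 𝓡.Arrows := 𝓡.isLocalHomeomorph_range.locallyCompactSpace_of_t2
  borelize 𝓡.Arrows
  have hU : ∀ n, MeasurableEmbedding ((↑) : 𝓡.U n → X) := fun n =>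
    MeasurableEmbedding.subtype_coe (𝓡.isOpen_U n).measurableSet
  have hR : ∀ n, MeasurableSet (𝓡.arrowsOf n) := fun n => (𝓡.isOpen_arrowsOf n).measurableSet
  have hDm : Measurable fun γ => ENNReal.ofReal (k.D γ) := k.continuous_D.measurable.ennreal_ofReal
  rw [isQuasiInvariant_iff_lintegral 𝓡.isLocalHomeomorph_range 𝓡.isLocalHomeomorph_source
    k.continuous_D (fun γ => (Real.exp_pos _).le)]
  constructor
  · intro h n
    refine dual_condOp_eq_self (𝓡.isProper n) (k.ρ_pos n) (k.continuous_ρ n) fun w hw => ?_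
    -- A kernel depending only on the source, with `w` extended by zero off `U n`; cutting it down
    -- to `R n` below turns the identity for arrows into the one for `w`.
    let F : 𝓡.Arrows → ℝ≥0∞ := fun γ => Function.extend ((↑) : 𝓡.U n → X) w 0 (Gap.source γ)
    have hF : Measurable F :=
      ((hU n).measurable_extend hw measurable_const).comp 𝓡.continuous_source.measurable
    have hK : ∀ x y : 𝓡.U n, 𝓡.R n x y → Gap.kernel n F x y = w y := fun x y hxy => by
      rw [Gap.kernel, dif_pos hxy]
      exact Subtype.val_injective.extend_apply w 0 y
    have key := h _ (hF.indicator (hR n))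
    rw [Gap.lintegral_fiberSum_range, Gap.lintegral_fiberSum_source] at key
    refine Eq.trans (lintegral_congr fun x => ?_) (key.trans (lintegral_congr fun y => ?_))
    · exact classSum_congr fun y hy => (hK x y hy).symm
    · exact classSum_congr fun z hz => by rw [hK z y ((𝓡.R n).symm hz)]
  · intro h
    have key : ∀ n (F : 𝓡.Arrows → ℝ≥0∞), Measurable F →
        ∫⁻ x, fiberSum Gap.range ((𝓡.arrowsOf n).indicator F) x ∂μ = ∫⁻ y, fiberSum Gap.source
          (fun γ => (𝓡.arrowsOf n).indicator F γ * ENNReal.ofReal (k.D γ)) y ∂μ := by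
      intro n F hF
      rw [Gap.lintegral_fiberSum_range, Gap.lintegral_fiberSum_source]
      refine lintegral_classSum_kernel_of_dual_eq (𝓡.isProper n) (k.ρ_pos n) (k.continuous_ρ n)
        (h n) ?_ ?_
      · simp only [← Gap.fiberSum_range_indicator]
        exact (measurable_fiberSum 𝓡.isLocalHomeomorph_range (hF.indicator (hR n))).comp
          measurable_subtype_coe
      · simp only [← Gap.fiberSum_source_indicator_mul_D]
        exact (measurable_fiberSum 𝓡.isLocalHomeomorph_source
          ((hF.indicator (hR n)).mul hDm)).comp measurable_subtype_coe
    intro F hF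
    -- The `R n` overlap and need not be nested, since the `U n` shrink. Making them disjoint splits
    -- `F` into pieces, each carried by one `R n`, to which `key` applies.
    let E : ℕ → Set 𝓡.Arrows := disjointed 𝓡.arrowsOf
    have hEm : ∀ n, MeasurableSet (E n) := fun n => MeasurableSet.disjointed hR n
    have hm : ∀ n, Measurable ((E n).indicator F) := fun n => hF.indicator (hEm n)
    have hmD : ∀ n, Measurable fun γ => (E n).indicator F γ * ENNReal.ofReal (k.D γ) :=
      fun n => (hm n).mul hDm
    have hE : ∀ n, (𝓡.arrowsOf n).indicator ((E n).indicator F) = (E n).indicator F := fun n => by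
      rw [indicator_indicator, inter_eq_right.2 (disjointed_subset _ _)]
    have hsum : F = fun γ => ∑' n, (E n).indicator F γ := by
      funext γ
      rw [← indicator_iUnion_eq_tsum (disjoint_disjointed _) F γ, iUnion_disjointed,
        𝓡.iUnion_arrowsOf, indicator_univ]
    rw [hsum]
    simp only [← ENNReal.tsum_mul_right]
    rw [fiberSum_tsum, fiberSum_tsum, lintegral_tsum fun n =>
      (measurable_fiberSum 𝓡.isLocalHomeomorph_range (hm n)).aemeasurable,
      lintegral_tsum fun n =>
      (measurable_fiberSum 𝓡.isLocalHomeomorph_source (hmD n)).aemeasurable]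
    refine tsum_congr fun n => ?_
    rw [← hE n]
    exact key n _ (hm n)
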